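/- Let $(\Omega,\mathcal F,\mathbb Q)$ be a probability space with a filtration $(\mathcal F_t)_{t\ge 0}$, let $\boldsymbol\mu\in\mathbb R^3$, $C\in\mathbb R^{2\times 2}$, $\Sigma\in\mathbb R^{3\times 3}$, and let $\mathbf W$ be a three-dimensional $(\mathcal F_t)$-Brownian motion under $\mathbb Q$ with covariance matrix $\Gamma\in\mathbb R^{3\times3}$ (symmetric positive semidefinite), that is, $\mathbf W$ is adapted, continuous, $\mathbf W(0)=\mathbf 0$, and for $s\le t$ the increment $\mathbf W(t)-\mathbf W(s)$ is independent of $\mathcal F_s$ and has law $N(\mathbf 0,(t-s)\Gamma)$. Let $\mathbf X$ be an adapted continuous process in $\mathbb R^3$ that solves $$ d\mathbf X(t)=\left(\boldsymbol\mu+\begin{bmatrix} C&\mathbf 0\\ \mathbf 0^\top&0\end{bmatrix}\mathbf X(t)\right)dt+\Sigma\,d\mathbf W(t),\qquad t\ge 0, $$ where $\mathbb E_{\mathbb Q}[\exp(\mathbf z^\top\mathbf X(0))]<\infty$ for every $\mathbf z\in\mathbb R^3$ (for example, $\mathbf X(0)$ deterministic). Put $$ \mathcal A(x)=\begin{bmatrix}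 e^{Cx}&\mathbf 0\\ \mathbf 0^\top&1\end{bmatrix}. $$ Then $\mathbf X$ is exponentially $\mathbb Q$-affine: for every $\mathbf z\in\mathbb R^3$ and $T\ge 0$ the variable $\mathbf z^\top\mathbf X(T)$ has a finite exponential moment, $\mathbb E_{\mathbb Q}[\exp(\mathbf z^\top\mathbf X(T))]<\infty$, and there are measurable functions $(t,T)\mapsto\boldsymbol\alpha(t,T;\mathbf z)\in\mathbb R^3$ and $(t,T)\mapsto a(t,T;\mathbf z)\in\mathbb R$ with $$ \mathbb E_{\mathbb Q}\left[\exp(\mathbf z^\top\mathbf X(T))\,|\,\mathcal F_t\right]=\exp\left(\boldsymbol\alpha(t,T;\mathbf z)^\top\mathbf X(t)+a(t,T;\mathbf z)\right)\quad\text{a.s. for all }0\le t\le T . $$ More precisely, this holds with $\boldsymbol\alpha(t,T;\mathbf z)=\mathcal A(T-t)^\top\mathbf z$ and $a(t,T;\mathbf z)=a(T-t;\mathbf z)$, where $$ a(x;\mathbf z)=\int_0^{x}\left(\mathbf z^\top\mathcal A(s)\boldsymbol\mu+\tfrac12\,\mathbf z^\top\mathcal A(s)\Sigma\,\Gamma\,\Sigma^\top\mathcal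 A(s)^\top\mathbf z\right)ds . $$ -/

import Mathlib

open MeasureTheory ProbabilityTheory
open scoped NNReal Matrix

noncomputable section

namespace FactorModel

/-- A three-dimensional Brownian motion with covariance matrix `Γ` (the covariance matrix of its
value at time one), relative to a filtration `𝓕` and under the probability `Q`: adapted, started
at zero, with continuous paths, and with increments over `[s, t]` that are independent of `𝓕 s`
and Gaussian with mean zero and covariance matrix `(t - s) Γ`. -/
structure IsBrownian3 {Ω : Type*} {m : MeasurableSpace Ω} (Q : Measure Ω)
    (𝓕 : Filtration ℝ≥0 m) (Γ : Matrix (Fin 3) (Fin 3) ℝ) (W : ℝ≥0 → Ω → Fin 3 → ℝ) : Prop where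
  posSemidef : Γ.PosSemidef
  adapted : Adapted 𝓕 W
  zero : ∀ᵐ ω ∂Q, W 0 ω = 0
  continuous : ∀ᵐ ω ∂Q, Continuous fun t => W t ω
  indep : ∀ s t : ℝ≥0, s ≤ t →
    Indep (MeasurableSpace.comap (fun ω => W t ω - W s ω) inferInstance) (𝓕 s) Q
  gaussian : ∀ s t : ℝ≥0, s ≤ t →
    HasLaw (fun ω => WithLp.toLp 2 (W t ω - W s ω))
      (multivariateGaussian 0 (((t : ℝ) - (s : ℝ)) • Γ)) Q

/-- The `3 × 3` block diagonal matrix with the `2 × 2` block `M` and the scalar block `c`. -/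
def blockDiag (M : Matrix (Fin 2) (Fin 2) ℝ) (c : ℝ) : Matrix (Fin 3) (Fin 3) ℝ :=
  !![M 0 0, M 0 1, 0;
     M 1 0, M 1 1, 0;
     0,     0,     c]

/-- `X` is a solution of the stochastic differential equation
`dX(t) = (μ + [C 0; 0 0] X(t)) dt + Σ dW(t)`: it is adapted, has continuous paths, and satisfies
the integrated equation for all times, almost surely. As `Σ` (here `S`) is constant, the
stochastic integral of `Σ` against `W` over `[0, t]` is `Σ (W(t) - W(0))`. -/
structure IsFactorProcess {Ω : Type*} {m : MeasurableSpace Ω} (Q : Measure Ω)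
    (𝓕 : Filtration ℝ≥0 m) (μ : Fin 3 → ℝ) (C : Matrix (Fin 2) (Fin 2) ℝ)
    (S : Matrix (Fin 3) (Fin 3) ℝ) (W X : ℝ≥0 → Ω → Fin 3 → ℝ) : Prop where
  adapted : Adapted 𝓕 X
  continuous : ∀ᵐ ω ∂Q, Continuous fun t => X t ω
  equation : ∀ᵐ ω ∂Q, ∀ t : ℝ≥0,
    X t ω = X 0 ω + (∫ s in (0 : ℝ)..(t : ℝ), (μ + blockDiag C 0 *ᵥ X s.toNNReal ω))
      + S *ᵥ (W t ω - W 0 ω)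

/-- `z ᵀ X` has a finite exponential moment at all times and for all `z`, the maps
`(t, T) ↦ α t T z` and `(t, T) ↦ a t T z` are measurable, and
`E_Q[exp(zᵀ X(T)) | 𝓕 t] = exp(α(t, T; z)ᵀ X(t) + a(t, T; z))` almost surely for `t ≤ T`. -/
structure IsExpAffineWith {n : ℕ} {Ω : Type*} {m : MeasurableSpace Ω} (Q : Measure Ω)
    (𝓕 : Filtration ℝ≥0 m) (X : ℝ≥0 → Ω → Fin n → ℝ)
    (α : ℝ≥0 → ℝ≥0 → (Fin n → ℝ) → Fin n → ℝ) (a : ℝ≥0 → ℝ≥0 → (Fin n → ℝ) → ℝ) : Prop where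
  exp_moment : ∀ (z : Fin n → ℝ) (T : ℝ≥0), Integrable (fun ω => Real.exp (z ⬝ᵥ X T ω)) Q
  measurable_vec : ∀ z : Fin n → ℝ, Measurable fun p : ℝ≥0 × ℝ≥0 => α p.1 p.2 z
  measurable_scalar : ∀ z : Fin n → ℝ, Measurable fun p : ℝ≥0 × ℝ≥0 => a p.1 p.2 z
  condExp_eq : ∀ (z : Fin n → ℝ) (t T : ℝ≥0), t ≤ T →
    Q[fun ω => Real.exp (z ⬝ᵥ X T ω) | 𝓕 t]
      =ᵐ[Q] fun ω => Real.exp (α t T z ⬝ᵥ X t ω + a t T z)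

/-- `X` is exponentially `Q`-affine. -/
def IsExpAffine {n : ℕ} {Ω : Type*} {m : MeasurableSpace Ω} (Q : Measure Ω)
    (𝓕 : Filtration ℝ≥0 m) (X : ℝ≥0 → Ω → Fin n → ℝ) : Prop :=
  ∃ (α : ℝ≥0 → ℝ≥0 → (Fin n → ℝ) → Fin n → ℝ) (a : ℝ≥0 → ℝ≥0 → (Fin n → ℝ) → ℝ),
    IsExpAffineWith Q 𝓕 X α a

/-- The matrix function `𝒜(x) = [exp(C x) 0; 0 1]`. -/
def semigroup (C : Matrix (Fin 2) (Fin 2) ℝ) (x : ℝ) : Matrix (Fin 3) (Fin 3) ℝ :=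
  blockDiag (NormedSpace.exp (x • C)) 1

/-- `a(x; z) = ∫₀ˣ (zᵀ 𝒜(s) μ + ½ zᵀ 𝒜(s) Σ Γ Σᵀ 𝒜(s)ᵀ z) ds`. -/
def scalarCoeff (μ : Fin 3 → ℝ) (C : Matrix (Fin 2) (Fin 2) ℝ)
    (S Γ : Matrix (Fin 3) (Fin 3) ℝ) (x : ℝ) (z : Fin 3 → ℝ) : ℝ :=
  ∫ s in (0 : ℝ)..x, (z ⬝ᵥ (semigroup C s *ᵥ μ)
    + (1 / 2 : ℝ) *
      (z ⬝ᵥ ((semigroup C s * S * Γ * Sᵀ * (semigroup C s)ᵀ) *ᵥ z)))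

end FactorModel

end

/-! Fix `T` and put α(s) = 𝒜(T - s)ᵀz, which solves the adjoint equation α' = -Aᵀα for the drift
matrix A. In d(αᵀX) the terms linear in X cancel, so zᵀX(T) = α(t)ᵀX(t) + c + Y with c = ∫ αᵀμ ds
and Y = ∫ αᵀΣ dW over [t, T]. As α is deterministic, Y is centred Gaussian and independent of `𝓕 t`;
the factor E[exp Y] = exp(v/2), with v the variance of Y, gives the formula. No stochastic integral
is needed: Y is defined as the remainder in this identity, and `tendsto_sum_dotProduct_increment`
shows path by path that it is a limit of weighted Brownian increments. Their characteristic
functions on events of `𝓕 t` (`IsBrownian3.setIntegral_cexp_sum`) pass to the limit and yield both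
law and independence. -/

noncomputable section

namespace FactorModel

open Filter Topology

/-! ### Riemann sums and pathwise Abel summation -/

/-- The `k`-th point of the partition of `[a, b]` into `n` intervals of equal length. -/
def gridPoint (a b : ℝ≥0) (n k : ℕ) : ℝ≥0 := a + k * ((b - a) / n)

lemma gridPoint_zero (a b : ℝ≥0) (n : ℕ) : gridPoint a b n 0 = a := by simp [gridPoint]

lemma gridPoint_last {a b : ℝ≥0} (hab : a ≤ b) {n : ℕ} (hn : n ≠ 0) : gridPoint a b n n = b := by
  have : (n : ℝ≥0) ≠ 0 := by exact_mod_cast hn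
  rw [gridPoint, mul_div_cancel₀ _ this, add_tsub_cancel_of_le hab]

lemma gridPoint_mono (a b : ℝ≥0) (n : ℕ) : Monotone (gridPoint a b n) := by
  intro i j hij
  unfold gridPoint
  gcongr

lemma gridPoint_succ_sub (a b : ℝ≥0) (n k : ℕ) :
    (gridPoint a b n (k + 1) : ℝ) - gridPoint a b n k = ((b - a : ℝ≥0) : ℝ) / n := by
  simp only [gridPoint]
  push_cast
  ring

/-- Riemann-type sums whose integrand on each cell may depend on both end points of the cell. -/
lemma tendsto_sum_integral_gridPoint {G : ℝ → ℝ → ℝ → ℝ}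
    (hG : Continuous fun p : ℝ × ℝ × ℝ => G p.1 p.2.1 p.2.2) {a b : ℝ≥0} (hab : a ≤ b) :
    Tendsto (fun n : ℕ => ∑ k ∈ Finset.range n,
      ∫ s in (gridPoint a b n k : ℝ)..(gridPoint a b n (k + 1) : ℝ),
        G (gridPoint a b n k) (gridPoint a b n (k + 1)) s)
      atTop (𝓝 (∫ s in (a : ℝ)..(b : ℝ), G s s s)) := by
  have hab' : (a : ℝ) ≤ b := by exact_mod_cast hab
  rw [Metric.tendsto_atTop]
  intro ε hε
  -- The cell errors add up to at most `e * (b - a)`; the `+ 1` keeps the divisor positive when `a =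
  -- b`.
  set e : ℝ := ε / (2 * ((b : ℝ) - a + 1)) with he
  have hba : 0 < (b : ℝ) - a + 1 := by linarith
  have he0 : 0 < e := by positivity
  set K : Set (ℝ × ℝ × ℝ) := Set.Icc (a : ℝ) b ×ˢ Set.Icc (a : ℝ) b ×ˢ Set.Icc (a : ℝ) b
  have hK : IsCompact K := isCompact_Icc.prod (isCompact_Icc.prod isCompact_Icc)
  have huc := hK.uniformContinuousOn_of_continuous hG.continuousOn
  obtain ⟨δ, hδ, hu⟩ := Metric.uniformContinuousOn_iff.1 huc e he0
  obtain ⟨N, hN⟩ := exists_nat_gt (((b - a : ℝ≥0) : ℝ) / δ)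
  refine ⟨N + 1, fun n hn => ?_⟩
  have hn0 : n ≠ 0 := by omega
  have hnpos : (0 : ℝ) < n := by positivity
  have hmesh : ((b - a : ℝ≥0) : ℝ) / n < δ := by
    rw [div_lt_iff₀ hnpos]
    rw [div_lt_iff₀ hδ] at hN
    have : (N : ℝ) ≤ n := by exact_mod_cast (by omega : N ≤ n)
    nlinarith
  set τ := gridPoint a b n
  have hdiag : Continuous fun s : ℝ => G s s s :=
    hG.comp (f := fun s : ℝ => (s, s, s)) (by fun_prop)
  have hcell : ∀ c d : ℝ, Continuous fun s : ℝ => G c d s := fun c d =>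
    hG.comp (f := fun s : ℝ => (c, d, s)) (by fun_prop)
  have hsplit : ∫ s in (a : ℝ)..(b : ℝ), G s s s
      = ∑ k ∈ Finset.range n, ∫ s in (τ k : ℝ)..(τ (k + 1) : ℝ), G s s s := by
    rw [intervalIntegral.sum_integral_adjacent_intervals (a := fun k => (τ k : ℝ))
      (fun k _ => hdiag.intervalIntegrable _ _)]
    simp only [τ, gridPoint_zero, gridPoint_last hab hn0]
  rw [Real.dist_eq, hsplit, ← Finset.sum_sub_distrib]
  have hbound : ∀ k ∈ Finset.range n,
      |(∫ s in (τ k : ℝ)..(τ (k + 1) : ℝ), G (τ k) (τ (k + 1)) s)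
        - ∫ s in (τ k : ℝ)..(τ (k + 1) : ℝ), G s s s| ≤ e * ((τ (k + 1) : ℝ) - τ k) := by
    intro k hk
    have hk' : k + 1 ≤ n := by simpa using hk
    have h1 : (τ k : ℝ) ≤ τ (k + 1) := by exact_mod_cast gridPoint_mono a b n (Nat.le_succ k)
    have h0 : (a : ℝ) ≤ τ k := by
      have := gridPoint_mono a b n (Nat.zero_le k)
      rw [gridPoint_zero] at this
      exact_mod_cast this
    have h2 : (τ (k + 1) : ℝ) ≤ b := by
      have := gridPoint_mono a b n hk'
      rw [gridPoint_last hab hn0] at this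
      exact_mod_cast this
    have h3 := gridPoint_succ_sub a b n k
    rw [← intervalIntegral.integral_sub ((hcell _ _).intervalIntegrable _ _)
      (hdiag.intervalIntegrable _ _), ← Real.norm_eq_abs, ← abs_of_nonneg (sub_nonneg.2 h1)]
    refine intervalIntegral.norm_integral_le_of_norm_le_const fun s hs => ?_
    rw [Set.uIoc_of_le h1] at hs
    have := hu ((τ k : ℝ), (τ (k + 1) : ℝ), s)
      ⟨⟨h0, by linarith⟩, ⟨by linarith, h2⟩, ⟨by linarith [hs.1], by linarith [hs.2]⟩⟩
      (s, s, s) ⟨⟨by linarith [hs.1], by linarith [hs.2]⟩, ⟨by linarith [hs.1], by linarith [hs.2]⟩,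
        ⟨by linarith [hs.1], by linarith [hs.2]⟩⟩ (by
        simp only [Prod.dist_eq, dist_self, Real.dist_eq]
        simp only [max_lt_iff, abs_lt]
        change (τ (k + 1) : ℝ) - τ k = _ at h3
        refine ⟨⟨?_, ?_⟩, ⟨?_, ?_⟩, hδ⟩ <;> linarith [hs.1, hs.2])
    rw [Real.dist_eq] at this
    exact this.le
  refine (Finset.abs_sum_le_sum_abs _ _).trans_lt ((Finset.sum_le_sum hbound).trans_lt ?_)
  rw [← Finset.mul_sum, Finset.sum_range_sub (fun k => (τ k : ℝ))]
  simp only [τ, gridPoint_zero, gridPoint_last hab hn0]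
  rw [he, div_mul_eq_mul_div, div_lt_iff₀ (by positivity)]
  nlinarith

lemma dotProduct_intervalIntegral {n : ℕ} (v : Fin n → ℝ) {f : ℝ → Fin n → ℝ} (hf : Continuous f)
    (a b : ℝ) : v ⬝ᵥ (∫ s in a..b, f s) = ∫ s in a..b, v ⬝ᵥ f s := by
  have := (LinearMap.toContinuousLinearMap
    (dotProductBilin ℝ ℝ (m := Fin n) (A := ℝ) v)).intervalIntegral_comp_comm
      (hf.intervalIntegrable (μ := volume) a b)
  exact this.symm

/-- Abel summation for the sums of `α` against the increments of a process `N` that drives the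
linear equation `dx = (μ + A x) dt + dN`, when `α` solves the adjoint equation `α' = -Aᵀ α`. -/
lemma tendsto_sum_dotProduct_increment {n : ℕ} {μ : Fin n → ℝ} {A : Matrix (Fin n) (Fin n) ℝ}
    {α : ℝ → Fin n → ℝ} (hα : ∀ s, HasDerivAt α (-(α s ᵥ* A)) s)
    {x N : ℝ≥0 → Fin n → ℝ} (hx : Continuous x)
    (heq : ∀ t : ℝ≥0, x t = x 0 + (∫ s in (0 : ℝ)..(t : ℝ), (μ + A *ᵥ x s.toNNReal)) + N t)
    {a b : ℝ≥0} (hab : a ≤ b) :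
    Tendsto (fun m : ℕ => ∑ k ∈ Finset.range m, α (gridPoint a b m k) ⬝ᵥ
      (N (gridPoint a b m (k + 1)) - N (gridPoint a b m k))) atTop
      (𝓝 (α b ⬝ᵥ x b - α a ⬝ᵥ x a - ∫ s in (a : ℝ)..(b : ℝ), α s ⬝ᵥ μ)) := by
  have hαc : Continuous α := continuous_iff_continuousAt.2 fun s => (hα s).continuousAt
  have hxc : Continuous fun s : ℝ => x s.toNNReal := hx.comp continuous_real_toNNReal
  have hfc : Continuous fun s : ℝ => μ + A *ᵥ x s.toNNReal := by fun_prop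
  have hα'c : Continuous fun s : ℝ => α s ᵥ* A := by fun_prop
  -- From Δ(α·x) = α(left)·Δx + Δα·x(right): `c` is the left end of a cell and `d` the right end. On
  -- the diagonal the two terms in `A` cancel.
  set G : ℝ → ℝ → ℝ → ℝ := fun c d s =>
    α c ⬝ᵥ (μ + A *ᵥ x s.toNNReal) - (α s ᵥ* A) ⬝ᵥ x d.toNNReal with hGdef
  have hG : Continuous fun p : ℝ × ℝ × ℝ => G p.1 p.2.1 p.2.2 := by
    have h1 : Continuous fun p : ℝ × ℝ × ℝ => α p.1 := by fun_prop
    have h2 : Continuous fun p : ℝ × ℝ × ℝ => μ + A *ᵥ x p.2.2.toNNReal :=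
      hfc.comp (f := fun p : ℝ × ℝ × ℝ => p.2.2) (by fun_prop)
    have h3 : Continuous fun p : ℝ × ℝ × ℝ => α p.2.2 ᵥ* A :=
      hα'c.comp (f := fun p : ℝ × ℝ × ℝ => p.2.2) (by fun_prop)
    have h4 : Continuous fun p : ℝ × ℝ × ℝ => x p.2.1.toNNReal :=
      hxc.comp (f := fun p : ℝ × ℝ × ℝ => p.2.1) (by fun_prop)
    exact (h1.dotProduct h2).sub (h3.dotProduct h4)
  have hGdiag : ∀ s, G s s s = α s ⬝ᵥ μ := by
    intro s
    simp [hGdef, dotProduct_add, Matrix.dotProduct_mulVec]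
  have hlim := tendsto_sum_integral_gridPoint hG hab
  simp only [hGdiag] at hlim
  refine (hlim.const_sub (α b ⬝ᵥ x b - α a ⬝ᵥ x a)).congr' ?_
  filter_upwards [eventually_ne_atTop 0] with m hm
  set τ := gridPoint a b m with hτ
  have htel : α b ⬝ᵥ x b - α a ⬝ᵥ x a
      = ∑ k ∈ Finset.range m, (α (τ (k + 1)) ⬝ᵥ x (τ (k + 1)) - α (τ k) ⬝ᵥ x (τ k)) := by
    rw [Finset.sum_range_sub (fun k => α (τ k) ⬝ᵥ x (τ k))]
    simp only [hτ, gridPoint_zero, gridPoint_last hab hm]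
  rw [htel, ← Finset.sum_sub_distrib]
  refine Finset.sum_congr rfl fun k _ => ?_
  have hN : N (τ (k + 1)) - N (τ k) = x (τ (k + 1)) - x (τ k)
      - ∫ s in (τ k : ℝ)..(τ (k + 1) : ℝ), (μ + A *ᵥ x s.toNNReal) := by
    have h1 := heq (τ (k + 1))
    have h2 := heq (τ k)
    have h3 := intervalIntegral.integral_interval_sub_left (μ := volume)
      (hfc.intervalIntegrable 0 (τ (k + 1) : ℝ)) (hfc.intervalIntegrable 0 (τ k : ℝ))
    rw [← h3, h1, h2]
    abel
  have hinc : α (τ (k + 1)) - α (τ k) = ∫ s in (τ k : ℝ)..(τ (k + 1) : ℝ), -(α s ᵥ* A) :=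
    (intervalIntegral.integral_eq_sub_of_hasDerivAt (fun s _ => hα s)
      (hα'c.neg.intervalIntegrable _ _)).symm
  have hinc' : (α (τ (k + 1)) - α (τ k)) ⬝ᵥ x (τ (k + 1))
      = ∫ s in (τ k : ℝ)..(τ (k + 1) : ℝ), -((α s ᵥ* A) ⬝ᵥ x (τ (k + 1))) := by
    rw [hinc, dotProduct_comm, dotProduct_intervalIntegral _ hα'c.fun_neg]
    refine intervalIntegral.integral_congr fun s _ => ?_
    simp only [dotProduct_neg]
    rw [dotProduct_comm]
  have hGint : ∫ s in (τ k : ℝ)..(τ (k + 1) : ℝ), G (τ k) (τ (k + 1)) s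
      = α (τ k) ⬝ᵥ (∫ s in (τ k : ℝ)..(τ (k + 1) : ℝ), (μ + A *ᵥ x s.toNNReal))
        + (α (τ (k + 1)) - α (τ k)) ⬝ᵥ x (τ (k + 1)) := by
    rw [hinc', dotProduct_intervalIntegral _ hfc, ← intervalIntegral.integral_add]
    · simp [hGdef, sub_eq_add_neg]
    · exact (continuous_const.dotProduct hfc).intervalIntegrable _ _
    · exact (hα'c.dotProduct continuous_const).neg.intervalIntegrable _ _
  rw [hGint, hN]
  simp only [dotProduct_sub, sub_dotProduct]
  ring

/-! ### Characteristic functions of weighted Brownian increments -/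

lemma IsBrownian3.measurable_increment {Ω : Type*} {m : MeasurableSpace Ω} {Q : Measure Ω}
    {𝓕 : Filtration ℝ≥0 m} {Γ : Matrix (Fin 3) (Fin 3) ℝ} {W : ℝ≥0 → Ω → Fin 3 → ℝ}
    (hW : IsBrownian3 Q 𝓕 Γ W) {s t r : ℝ≥0} (hs : s ≤ r) (ht : t ≤ r) (θ : Fin 3 → ℝ) :
    Measurable[𝓕 r] fun ω => θ ⬝ᵥ (W t ω - W s ω) := by
  have h1 : Measurable[𝓕 r] (W t) := (hW.adapted t).mono (𝓕.mono ht) le_rfl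
  have h2 : Measurable[𝓕 r] (W s) := (hW.adapted s).mono (𝓕.mono hs) le_rfl
  have h3 : Measurable fun v : Fin 3 → ℝ => θ ⬝ᵥ v := by fun_prop
  exact h3.comp (h1.sub h2)

/-- The characteristic function of an increment. -/
lemma IsBrownian3.integral_cexp_increment {Ω : Type*} {m : MeasurableSpace Ω} {Q : Measure Ω}
    {𝓕 : Filtration ℝ≥0 m} {Γ : Matrix (Fin 3) (Fin 3) ℝ} {W : ℝ≥0 → Ω → Fin 3 → ℝ}
    (hW : IsBrownian3 Q 𝓕 Γ W) {s t : ℝ≥0} (hst : s ≤ t) (θ : Fin 3 → ℝ) :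
    ∫ ω, Complex.exp (((θ ⬝ᵥ (W t ω - W s ω) : ℝ) : ℂ) * Complex.I) ∂Q
      = Complex.exp (-((((t : ℝ) - s) * (θ ⬝ᵥ (Γ *ᵥ θ)) : ℝ) : ℂ) / 2) := by
  have hpos : (((t : ℝ) - (s : ℝ)) • Γ).PosSemidef :=
    hW.posSemidef.smul (sub_nonneg.2 (by exact_mod_cast hst))
  have h1 := charFun_multivariateGaussian (μ := 0) hpos (WithLp.toLp 2 θ)
  rw [charFun_apply, ← (hW.gaussian s t hst).integral_comp (by fun_prop)] at h1
  convert h1 using 3 with ω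
  · simp [EuclideanSpace.inner_eq_star_dotProduct]
  · simp [Matrix.smul_mulVec]
    ring

/-- The joint behaviour of an event at the initial time and of a sum of weighted increments. -/
lemma IsBrownian3.setIntegral_cexp_sum {Ω : Type*} {m : MeasurableSpace Ω} {Q : Measure Ω}
    [IsProbabilityMeasure Q]
    {𝓕 : Filtration ℝ≥0 m} {Γ : Matrix (Fin 3) (Fin 3) ℝ} {W : ℝ≥0 → Ω → Fin 3 → ℝ}
    (hW : IsBrownian3 Q 𝓕 Γ W) {τ : ℕ → ℝ≥0} (hτ : Monotone τ) (θ : ℕ → Fin 3 → ℝ)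
    {B : Set Ω} (hB : MeasurableSet[𝓕 (τ 0)] B) (k : ℕ) :
    ∫ ω in B, Complex.exp
        (((∑ j ∈ Finset.range k, θ j ⬝ᵥ (W (τ (j + 1)) ω - W (τ j) ω) : ℝ) : ℂ) * Complex.I) ∂Q
      = Q.real B * Complex.exp
        (-((∑ j ∈ Finset.range k, ((τ (j + 1) : ℝ) - τ j) * (θ j ⬝ᵥ (Γ *ᵥ θ j)) : ℝ) : ℂ) / 2) := by
  have hBm : MeasurableSet B := 𝓕.le _ B hB
  induction k with
  | zero => simp
  | succ k ih =>
    set R : Ω → ℝ := fun ω => ∑ j ∈ Finset.range k, θ j ⬝ᵥ (W (τ (j + 1)) ω - W (τ j) ω) with hR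
    have hRm : Measurable[𝓕 (τ k)] R := by
      refine Finset.measurable_fun_sum _ fun j hj => ?_
      have hj' : j + 1 ≤ k := by simpa using hj
      exact hW.measurable_increment (hτ (by omega)) (hτ hj') _
    have he : Measurable fun r : ℝ => Complex.exp ((r : ℂ) * Complex.I) := by fun_prop
    -- With the indicator of `B` inside the past factor, independence of the next increment from `𝓕
    -- (τ k)` splits the integral over `B` as well.
    set f : Ω → ℂ := B.indicator fun ω => Complex.exp ((R ω : ℂ) * Complex.I) with hf
    have hfm : Measurable[𝓕 (τ k)] f :=
      (he.comp hRm).indicator (𝓕.mono (hτ (Nat.zero_le k)) B hB)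
    set g : Ω → ℂ := fun ω =>
      Complex.exp (((θ k ⬝ᵥ (W (τ (k + 1)) ω - W (τ k) ω) : ℝ) : ℂ) * Complex.I) with hg
    have hgm : Measurable g :=
      he.comp ((hW.measurable_increment (hτ (Nat.le_succ k)) le_rfl _).mono (𝓕.le _) le_rfl)
    have hgc : MeasurableSpace.comap g inferInstance ≤
        MeasurableSpace.comap (fun ω => W (τ (k + 1)) ω - W (τ k) ω) inferInstance := by
      have h3 : Measurable fun v : Fin 3 → ℝ =>
          Complex.exp (((θ k ⬝ᵥ v : ℝ) : ℂ) * Complex.I) := by fun_prop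
      exact (h3.comp (comap_measurable (fun ω => W (τ (k + 1)) ω - W (τ k) ω))).comap_le
    have hind : IndepFun f g Q :=
      (indep_of_indep_of_le_left (indep_of_indep_of_le_right
        (hW.indep _ _ (hτ (Nat.le_succ k))) hfm.comap_le) hgc).symm
    have hmul := hind.integral_fun_mul_eq_mul_integral
      (hfm.mono (𝓕.le _) le_rfl).aestronglyMeasurable hgm.aestronglyMeasurable
    rw [← integral_indicator hBm] at ih ⊢
    rw [hW.integral_cexp_increment (hτ (Nat.le_succ k)), ih] at hmul
    rw [Finset.sum_range_succ, Complex.ofReal_add, neg_add, add_div, Complex.exp_add, ← mul_assoc,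
      ← hmul]
    refine integral_congr_ae (Eventually.of_forall fun ω => ?_)
    by_cases hω : ω ∈ B
    · simp only [hf, hg, hR, Set.indicator_of_mem hω]
      rw [Finset.sum_range_succ, Complex.ofReal_add, add_mul, Complex.exp_add]
    · simp only [hf, Set.indicator_of_notMem hω, zero_mul]

/-! ### Gaussian limits independent of the past -/

/-- The law of `Y` on an event is determined by its characteristic function there. -/
lemma restrict_map_eq_smul_gaussianReal {Ω : Type*} {m : MeasurableSpace Ω} {Q : Measure Ω}
    [IsProbabilityMeasure Q] {Y : Ω → ℝ} (hY : Measurable Y) {v : ℝ≥0} {B : Set Ω}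
    (h : ∀ u : ℝ, ∫ ω in B, Complex.exp (((u * Y ω : ℝ) : ℂ) * Complex.I) ∂Q
      = Q.real B * Complex.exp (-((u ^ 2 * v : ℝ) : ℂ) / 2)) :
    (Q.restrict B).map Y = Q B • gaussianReal 0 v := by
  have : IsFiniteMeasure (Q B • gaussianReal 0 v) :=
    Measure.smul_finite _ (measure_ne_top Q B)
  refine Measure.ext_of_charFun (funext fun u => ?_)
  rw [charFun_apply_real, integral_map hY.aemeasurable (by fun_prop), charFun_apply_real,
    integral_smul_measure, ← charFun_apply_real, charFun_gaussianReal]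
  have := h u
  push_cast at this
  rw [this]
  simp [Measure.real]
  ring_nf
  simp

/-- Taking `B` to be the whole space identifies the law of `Y`; the identity for general `B` then
reads as the product formula for independence. -/
lemma indep_and_hasLaw_gaussianReal {Ω : Type*} {m' m : MeasurableSpace Ω} {Q : Measure Ω}
    [IsProbabilityMeasure Q] {Y : Ω → ℝ} (hY : Measurable Y) {v : ℝ≥0}
    (h : ∀ B, MeasurableSet[m'] B → (Q.restrict B).map Y = Q B • gaussianReal 0 v) :
    Indep (MeasurableSpace.comap Y inferInstance) m' Q ∧ HasLaw Y (gaussianReal 0 v) Q := by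
  have hlaw : Q.map Y = gaussianReal 0 v := by
    simpa using h Set.univ MeasurableSet.univ
  refine ⟨?_, ⟨hY.aemeasurable, hlaw⟩⟩
  rw [Indep_iff]
  rintro _ B ⟨A, hA, rfl⟩ hB
  have := congrArg (fun ν : Measure ℝ => ν A) (h B hB)
  simp only [Measure.smul_apply, smul_eq_mul] at this
  rw [Measure.map_apply hY hA, Measure.restrict_apply (hY hA), ← hlaw, Measure.map_apply hY hA]
    at this
  rw [this, mul_comm]

/-- Passing to the limit in the characteristic functions on an event. -/
lemma setIntegral_cexp_of_tendsto {Ω : Type*} {m : MeasurableSpace Ω} {Q : Measure Ω}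
    [IsProbabilityMeasure Q] {R : ℕ → Ω → ℝ} (hR : ∀ n, Measurable (R n)) {Y : Ω → ℝ}
    (hlim : ∀ᵐ ω ∂Q, Tendsto (fun n => R n ω) atTop (𝓝 (Y ω))) {V : ℕ → ℝ} {v : ℝ}
    (hV : Tendsto V atTop (𝓝 v)) {B : Set Ω} (u : ℝ)
    (h : ∀ n, ∫ ω in B, Complex.exp (((u * R n ω : ℝ) : ℂ) * Complex.I) ∂Q
      = Q.real B * Complex.exp (-((u ^ 2 * V n : ℝ) : ℂ) / 2)) :
    ∫ ω in B, Complex.exp (((u * Y ω : ℝ) : ℂ) * Complex.I) ∂Q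
      = Q.real B * Complex.exp (-((u ^ 2 * v : ℝ) : ℂ) / 2) := by
  have hleft : Tendsto (fun n => ∫ ω in B, Complex.exp (((u * R n ω : ℝ) : ℂ) * Complex.I) ∂Q)
      atTop (𝓝 (∫ ω in B, Complex.exp (((u * Y ω : ℝ) : ℂ) * Complex.I) ∂Q)) := by
    refine tendsto_integral_of_dominated_convergence (fun _ => 1) (fun n => ?_)
      (integrable_const _) (fun n => ?_) ?_
    · have := hR n
      exact Measurable.aestronglyMeasurable (by fun_prop)
    · exact Eventually.of_forall fun ω => (Complex.norm_exp_ofReal_mul_I _).le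
    · filter_upwards [ae_restrict_of_ae hlim] with ω hω
      have hc : Continuous fun r : ℝ => Complex.exp (((u * r : ℝ) : ℂ) * Complex.I) := by fun_prop
      exact (hc.tendsto _).comp hω
  have hc : Continuous fun r : ℝ => (Q.real B : ℂ) * Complex.exp (-((u ^ 2 * r : ℝ) : ℂ) / 2) := by
    fun_prop
  simp only [h] at hleft
  exact tendsto_nhds_unique hleft ((hc.tendsto _).comp hV)

/-- Almost sure limits of sums of weighted increments after time `a` are Gaussian and independent
of the events up to time `a`. -/
lemma IsBrownian3.indep_and_hasLaw_of_tendsto {Ω : Type*} {m : MeasurableSpace Ω} {Q : Measure Ω}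
    [IsProbabilityMeasure Q]
    {𝓕 : Filtration ℝ≥0 m} {Γ : Matrix (Fin 3) (Fin 3) ℝ} {W : ℝ≥0 → Ω → Fin 3 → ℝ}
    (hW : IsBrownian3 Q 𝓕 Γ W) {β : ℝ → Fin 3 → ℝ} (hβ : Continuous β) {a b : ℝ≥0} (hab : a ≤ b)
    {Y : Ω → ℝ} (hY : Measurable Y)
    (hlim : ∀ᵐ ω ∂Q, Tendsto (fun n : ℕ => ∑ k ∈ Finset.range n, β (gridPoint a b n k) ⬝ᵥ
      (W (gridPoint a b n (k + 1)) ω - W (gridPoint a b n k) ω)) atTop (𝓝 (Y ω))) :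
    Indep (MeasurableSpace.comap Y inferInstance) (𝓕 a) Q ∧
      HasLaw Y (gaussianReal 0
        (∫ s in (a : ℝ)..(b : ℝ), β s ⬝ᵥ (Γ *ᵥ β s)).toNNReal) Q := by
  have hqc : Continuous fun s => β s ⬝ᵥ (Γ *ᵥ β s) := by fun_prop
  have hq0 : 0 ≤ ∫ s in (a : ℝ)..(b : ℝ), β s ⬝ᵥ (Γ *ᵥ β s) :=
    intervalIntegral.integral_nonneg (by exact_mod_cast hab) fun s _ => by
      simpa using hW.posSemidef.dotProduct_mulVec_nonneg (β s)
  -- The variances of the sums are Riemann sums: the integrand is frozen at the left end of each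
  -- cell.
  have hvar := tendsto_sum_integral_gridPoint (G := fun c _ _ => β c ⬝ᵥ (Γ *ᵥ β c))
    (hqc.comp (f := fun p : ℝ × ℝ × ℝ => p.1) (by fun_prop)) hab
  simp only [intervalIntegral.integral_const, smul_eq_mul] at hvar
  refine indep_and_hasLaw_gaussianReal hY fun B hB =>
    restrict_map_eq_smul_gaussianReal hY fun u => ?_
  rw [Real.coe_toNNReal _ hq0]
  refine setIntegral_cexp_of_tendsto (fun n => Finset.measurable_fun_sum _ fun k _ =>
    (hW.measurable_increment (gridPoint_mono a b n (Nat.le_succ k)) le_rfl _).mono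
      (𝓕.le _) le_rfl) hlim hvar u fun n => ?_
  have := hW.setIntegral_cexp_sum (gridPoint_mono a b n) (fun k => u • β (gridPoint a b n k))
    (B := B) (by rwa [gridPoint_zero]) n
  simp only [smul_dotProduct, smul_eq_mul, ← Finset.mul_sum] at this
  rw [this, Finset.mul_sum]
  congr 5
  refine Finset.sum_congr rfl fun k _ => ?_
  simp only [Matrix.mulVec_smul, dotProduct_smul, smul_eq_mul]
  ring

/-! ### The matrix function 𝒜 and the scalar coefficient -/

lemma hasDerivAt_exp_smul_apply (C : Matrix (Fin 2) (Fin 2) ℝ) (x : ℝ) (i j : Fin 2) :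
    HasDerivAt (fun u : ℝ => NormedSpace.exp (u • C) i j) ((NormedSpace.exp (x • C) * C) i j) x := by
  -- A norm is chosen only inside this proof; the entrywise conclusion does not mention it.
  let _ : NormedRing (Matrix (Fin 2) (Fin 2) ℝ) := Matrix.linftyOpNormedRing
  let _ : NormedAlgebra ℝ (Matrix (Fin 2) (Fin 2) ℝ) := Matrix.linftyOpNormedAlgebra
  have h : HasDerivAt (fun u : ℝ => NormedSpace.exp (u • C)) (NormedSpace.exp (x • C) * C) x :=
    hasDerivAt_exp_smul_const C x
  exact (LinearMap.toContinuousLinearMap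
    (Matrix.entryLinearMap ℝ ℝ i j)).hasFDerivAt.comp_hasDerivAt x h

/-- `s ↦ 𝒜(T - s)ᵀ z` solves the adjoint equation. -/
lemma hasDerivAt_semigroup_transpose_mulVec (C : Matrix (Fin 2) (Fin 2) ℝ) (T : ℝ)
    (z : Fin 3 → ℝ) (s : ℝ) :
    HasDerivAt (fun u : ℝ => (semigroup C (T - u))ᵀ *ᵥ z)
      (-(((semigroup C (T - s))ᵀ *ᵥ z) ᵥ* blockDiag C 0)) s := by
  have h : ∀ i j, HasDerivAt (fun u : ℝ => NormedSpace.exp ((T - u) • C) i j)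
      (-((NormedSpace.exp ((T - s) • C) * C) i j)) s := fun i j => by
    simpa using (hasDerivAt_exp_smul_apply C (T - s) i j).comp_const_sub T s
  refine hasDerivAt_pi.2 fun i => ?_
  fin_cases i
  · have := ((h 0 0).mul_const (z 0)).add ((h 1 0).mul_const (z 1))
    convert this using 1
    · ext u
      simp [semigroup, blockDiag, Matrix.mulVec, dotProduct, Fin.sum_univ_three]
    · simp only [Pi.neg_apply, Matrix.mulVec, Matrix.vecMul, dotProduct, Fin.sum_univ_three,
        semigroup, Matrix.mul_apply, Fin.sum_univ_two, Matrix.transpose_apply]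
      simp [blockDiag]
      ring
  · have := ((h 0 1).mul_const (z 0)).add ((h 1 1).mul_const (z 1))
    convert this using 1
    · ext u
      simp [semigroup, blockDiag, Matrix.mulVec, dotProduct, Fin.sum_univ_three]
    · simp only [Pi.neg_apply, Matrix.mulVec, Matrix.vecMul, dotProduct, Fin.sum_univ_three,
        semigroup, Matrix.mul_apply, Fin.sum_univ_two, Matrix.transpose_apply]
      simp [blockDiag]
      ring
  · convert hasDerivAt_const s (z 2) using 1
    · ext u
      simp [semigroup, blockDiag, Matrix.mulVec, dotProduct, Fin.sum_univ_three]
    · simp [blockDiag, Matrix.vecMul_eq_sum, Fin.sum_univ_three]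

lemma semigroup_zero (C : Matrix (Fin 2) (Fin 2) ℝ) : semigroup C 0 = 1 := by
  ext i j
  fin_cases i <;> fin_cases j <;> simp [semigroup, blockDiag]

lemma continuous_semigroup_transpose_mulVec (C : Matrix (Fin 2) (Fin 2) ℝ) (z : Fin 3 → ℝ) :
    Continuous fun x : ℝ => (semigroup C x)ᵀ *ᵥ z := by
  -- The derivative is available for the time-reversed function; take `T = 0` and reflect.
  have h : Continuous fun u : ℝ => (semigroup C (0 - u))ᵀ *ᵥ z :=
    continuous_iff_continuousAt.2 fun s =>
      (hasDerivAt_semigroup_transpose_mulVec C 0 z s).continuousAt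
  simpa [Function.comp_def] using h.comp continuous_neg

lemma dotProduct_semigroup_mulVec (C : Matrix (Fin 2) (Fin 2) ℝ) (x : ℝ) (z μ : Fin 3 → ℝ) :
    z ⬝ᵥ (semigroup C x *ᵥ μ) = ((semigroup C x)ᵀ *ᵥ z) ⬝ᵥ μ := by
  rw [Matrix.dotProduct_mulVec, Matrix.mulVec_transpose]

/-- Writes the quadratic form through β = Σᵀ𝒜ᵀz, the weight of the Brownian increments, to match the
variance of the Gaussian limit. -/
lemma dotProduct_covariance_mulVec (C : Matrix (Fin 2) (Fin 2) ℝ) (S Γ : Matrix (Fin 3) (Fin 3) ℝ)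
    (x : ℝ) (z : Fin 3 → ℝ) :
    z ⬝ᵥ ((semigroup C x * S * Γ * Sᵀ * (semigroup C x)ᵀ) *ᵥ z)
      = (((semigroup C x)ᵀ *ᵥ z) ᵥ* S) ⬝ᵥ (Γ *ᵥ (((semigroup C x)ᵀ *ᵥ z) ᵥ* S)) := by
  rw [← Matrix.mulVec_transpose S]
  simp only [← Matrix.mulVec_mulVec, Matrix.dotProduct_mulVec z, Matrix.mulVec_transpose]
  simp only [Matrix.dotProduct_mulVec]

lemma continuous_integrand (μ : Fin 3 → ℝ) (C : Matrix (Fin 2) (Fin 2) ℝ)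
    (S Γ : Matrix (Fin 3) (Fin 3) ℝ) (z : Fin 3 → ℝ) :
    Continuous fun s : ℝ => z ⬝ᵥ (semigroup C s *ᵥ μ) + (1 / 2 : ℝ) *
      (z ⬝ᵥ ((semigroup C s * S * Γ * Sᵀ * (semigroup C s)ᵀ) *ᵥ z)) := by
  simp only [dotProduct_semigroup_mulVec, dotProduct_covariance_mulVec]
  have := continuous_semigroup_transpose_mulVec C z
  fun_prop

/-- The substitution s ↦ T - s turns the coefficient into the drift term plus half the variance over
[t, T]. -/
lemma scalarCoeff_sub (μ : Fin 3 → ℝ) (C : Matrix (Fin 2) (Fin 2) ℝ)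
    (S Γ : Matrix (Fin 3) (Fin 3) ℝ) (z : Fin 3 → ℝ) (t T : ℝ) :
    scalarCoeff μ C S Γ (T - t) z
      = (∫ s in t..T, ((semigroup C (T - s))ᵀ *ᵥ z) ⬝ᵥ μ)
        + (∫ s in t..T, (((semigroup C (T - s))ᵀ *ᵥ z) ᵥ* S) ⬝ᵥ
            (Γ *ᵥ (((semigroup C (T - s))ᵀ *ᵥ z) ᵥ* S))) / 2 := by
  have hc : Continuous fun s : ℝ => (semigroup C (T - s))ᵀ *ᵥ z :=
    (continuous_semigroup_transpose_mulVec C z).comp (f := fun s : ℝ => T - s) (by fun_prop)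
  have h := intervalIntegral.integral_comp_sub_left (a := t) (b := T)
    (fun s => z ⬝ᵥ (semigroup C s *ᵥ μ) + (1 / 2 : ℝ) *
      (z ⬝ᵥ ((semigroup C s * S * Γ * Sᵀ * (semigroup C s)ᵀ) *ᵥ z))) T
  rw [sub_self] at h
  rw [scalarCoeff, ← h]
  simp only [dotProduct_semigroup_mulVec, dotProduct_covariance_mulVec]
  rw [intervalIntegral.integral_add (Continuous.intervalIntegrable (by fun_prop) _ _)
    (Continuous.intervalIntegrable (by fun_prop) _ _), intervalIntegral.integral_const_mul]
  ring

/-! ### Gaussian decomposition and conditional expectation -/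

section Factor

variable {Ω : Type*} {m : MeasurableSpace Ω} {Q : Measure Ω} {𝓕 : Filtration ℝ≥0 m}
  {μ : Fin 3 → ℝ} {C : Matrix (Fin 2) (Fin 2) ℝ} {S Γ : Matrix (Fin 3) (Fin 3) ℝ}
  {W X : ℝ≥0 → Ω → Fin 3 → ℝ}

lemma IsFactorProcess.measurable_dotProduct (hX : IsFactorProcess Q 𝓕 μ C S W X) (v : Fin 3 → ℝ)
    (t : ℝ≥0) : Measurable[𝓕 t] fun ω => v ⬝ᵥ X t ω := by
  have h : Measurable fun x : Fin 3 → ℝ => v ⬝ᵥ x := by fun_prop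
  exact h.comp (hX.adapted t)

/-- Given `𝓕 t`, the variable `zᵀ X(T)` splits into a known part and an independent centred
Gaussian part. -/
lemma IsFactorProcess.exists_gaussian_decomposition [IsProbabilityMeasure Q]
    (hW : IsBrownian3 Q 𝓕 Γ W) (hX : IsFactorProcess Q 𝓕 μ C S W X) (z : Fin 3 → ℝ)
    {t T : ℝ≥0} (hT : t ≤ T) :
    ∃ (Y : Ω → ℝ) (c : ℝ) (v : ℝ≥0), Measurable Y ∧
      Indep (MeasurableSpace.comap Y inferInstance) (𝓕 t) Q ∧ HasLaw Y (gaussianReal 0 v) Q ∧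
      c + v / 2 = scalarCoeff μ C S Γ ((T : ℝ) - t) z ∧
      ∀ ω, z ⬝ᵥ X T ω = ((semigroup C ((T : ℝ) - t))ᵀ *ᵥ z) ⬝ᵥ X t ω + c + Y ω := by
  set α : ℝ → Fin 3 → ℝ := fun s => (semigroup C ((T : ℝ) - s))ᵀ *ᵥ z with hα
  have hαd : ∀ s, HasDerivAt α (-(α s ᵥ* blockDiag C 0)) s :=
    hasDerivAt_semigroup_transpose_mulVec C T z
  have hαc : Continuous α := continuous_iff_continuousAt.2 fun s => (hαd s).continuousAt
  have hαT : α T = z := by simp [hα, semigroup_zero]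
  -- Defined as a remainder, `Y` makes the decomposition hold for every ω; null sets enter only in
  -- the limit `hlim`.
  set Y : Ω → ℝ := fun ω => α T ⬝ᵥ X T ω - α t ⬝ᵥ X t ω - ∫ s in (t : ℝ)..(T : ℝ), α s ⬝ᵥ μ
  have hY : Measurable Y :=
    (((hX.measurable_dotProduct (α T) T).mono (𝓕.le _) le_rfl).sub
      ((hX.measurable_dotProduct (α t) t).mono (𝓕.le _) le_rfl)).sub_const _
  have hlim : ∀ᵐ ω ∂Q, Tendsto (fun n : ℕ => ∑ k ∈ Finset.range n,
      (α (gridPoint t T n k) ᵥ* S) ⬝ᵥ (W (gridPoint t T n (k + 1)) ω - W (gridPoint t T n k) ω))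
      atTop (𝓝 (Y ω)) := by
    filter_upwards [hX.continuous, hX.equation] with ω hc heq
    have := tendsto_sum_dotProduct_increment (N := fun t => S *ᵥ (W t ω - W 0 ω)) hαd hc heq hT
    refine this.congr fun n => Finset.sum_congr rfl fun k _ => ?_
    rw [← Matrix.mulVec_sub, sub_sub_sub_cancel_right, Matrix.dotProduct_mulVec]
  have hβc : Continuous fun s => α s ᵥ* S := by fun_prop
  obtain ⟨hind, hlaw⟩ := hW.indep_and_hasLaw_of_tendsto hβc hT hY hlim
  refine ⟨Y, ∫ s in (t : ℝ)..(T : ℝ), α s ⬝ᵥ μ, _, hY, hind, hlaw, ?_, fun ω => ?_⟩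
  · rw [scalarCoeff_sub, Real.coe_toNNReal]
    exact intervalIntegral.integral_nonneg (by exact_mod_cast hT) fun s _ => by
      simpa using hW.posSemidef.dotProduct_mulVec_nonneg (α s ᵥ* S)
  · simp only [Y, hαT]
    ring

lemma integrable_exp_of_hasLaw_gaussianReal {Y : Ω → ℝ} {v : ℝ≥0}
    (h : HasLaw Y (gaussianReal 0 v) Q) : Integrable (fun ω => Real.exp (Y ω)) Q := by
  have h1 := integrable_exp_mul_gaussianReal (μ := 0) (v := v) 1
  rw [← h.map_eq] at h1
  simpa [Function.comp_def] using h1.comp_aemeasurable h.aemeasurable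

lemma indepFun_exp_exp {m' : MeasurableSpace Ω} {f Y : Ω → ℝ} (hf : Measurable[m'] f)
    (h : Indep (MeasurableSpace.comap Y inferInstance) m' Q) :
    IndepFun (fun ω => Real.exp (f ω)) (fun ω => Real.exp (Y ω)) Q := by
  have h1 : Measurable[m'] fun ω => Real.exp (f ω) := Real.measurable_exp.comp hf
  have h2 : Measurable[MeasurableSpace.comap Y inferInstance] fun ω => Real.exp (Y ω) :=
    Real.measurable_exp.comp (comap_measurable Y)
  exact (indep_of_indep_of_le_left (indep_of_indep_of_le_right h h1.comap_le) h2.comap_le).symm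

/-- The decomposition from time 0 gives a product of independent integrable factors. The vector
paired with X(0) is 𝒜(T)ᵀz, so `hX0` is applied at a vector other than `z`. -/
lemma IsFactorProcess.integrable_exp_dotProduct [IsProbabilityMeasure Q]
    (hW : IsBrownian3 Q 𝓕 Γ W) (hX : IsFactorProcess Q 𝓕 μ C S W X)
    (hX0 : ∀ z : Fin 3 → ℝ, Integrable (fun ω => Real.exp (z ⬝ᵥ X 0 ω)) Q)
    (z : Fin 3 → ℝ) (T : ℝ≥0) : Integrable (fun ω => Real.exp (z ⬝ᵥ X T ω)) Q := by
  obtain ⟨Y, c, v, -, hind, hlaw, -, heq⟩ := hX.exists_gaussian_decomposition hW z (zero_le (a := T))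
  have := (indepFun_exp_exp (hX.measurable_dotProduct
    ((semigroup C ((T : ℝ) - (0 : ℝ≥0)))ᵀ *ᵥ z) 0) hind).integrable_mul (hX0 _)
    (integrable_exp_of_hasLaw_gaussianReal hlaw)
  refine (this.const_mul (Real.exp c)).congr (Eventually.of_forall fun ω => ?_)
  simp only [heq, Pi.mul_apply, Real.exp_add]
  ring

/-- The known factor is pulled out, and the independent factor exp(Y) is replaced by its mean
exp(v/2), which joins `c` to form the scalar coefficient. -/
lemma IsFactorProcess.condExp_exp_dotProduct [IsProbabilityMeasure Q]
    (hW : IsBrownian3 Q 𝓕 Γ W) (hX : IsFactorProcess Q 𝓕 μ C S W X)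
    (hX0 : ∀ z : Fin 3 → ℝ, Integrable (fun ω => Real.exp (z ⬝ᵥ X 0 ω)) Q)
    (z : Fin 3 → ℝ) {t T : ℝ≥0} (hT : t ≤ T) :
    Q[fun ω => Real.exp (z ⬝ᵥ X T ω) | 𝓕 t] =ᵐ[Q] fun ω =>
      Real.exp (((semigroup C ((T : ℝ) - t))ᵀ *ᵥ z) ⬝ᵥ X t ω
        + scalarCoeff μ C S Γ ((T : ℝ) - t) z) := by
  obtain ⟨Y, c, v, hYm, hind, hlaw, hc, heq⟩ := hX.exists_gaussian_decomposition hW z hT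
  set α := (semigroup C ((T : ℝ) - t))ᵀ *ᵥ z
  have hα := hX.measurable_dotProduct α t
  have hYi := integrable_exp_of_hasLaw_gaussianReal hlaw
  have hint := (indepFun_exp_exp hα hind).integrable_mul
    (hX.integrable_exp_dotProduct hW hX0 α t) hYi
  have hmeas : Measurable[𝓕 t] fun ω => Real.exp (α ⬝ᵥ X t ω + c) :=
    Real.measurable_exp.comp (hα.add_const c)
  have hprod : (fun ω => Real.exp (z ⬝ᵥ X T ω))
      = (fun ω => Real.exp (α ⬝ᵥ X t ω + c)) * fun ω => Real.exp (Y ω) := by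
    ext ω
    simp only [heq, Pi.mul_apply, Real.exp_add]
  have hY : ∫ ω, Real.exp (Y ω) ∂Q = Real.exp (v / 2) := by
    simpa [mgf] using mgf_gaussianReal hlaw.map_eq 1
  have hYc : Q[fun ω => Real.exp (Y ω) | 𝓕 t] =ᵐ[Q] fun _ => Real.exp (v / 2) := by
    have hsm : StronglyMeasurable[MeasurableSpace.comap Y inferInstance]
        fun ω => Real.exp (Y ω) :=
      (Real.measurable_exp.comp (comap_measurable Y)).stronglyMeasurable
    simpa only [hY] using condExp_indep_eq hYm.comap_le (𝓕.le t) hsm hind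
  have hpull := condExp_mul_of_stronglyMeasurable_left (μ := Q) hmeas.stronglyMeasurable
    (hprod ▸ hX.integrable_exp_dotProduct hW hX0 z T) hYi
  rw [hprod]
  filter_upwards [hpull, hYc] with ω h1 h2
  rw [h1, Pi.mul_apply, h2, ← Real.exp_add, ← hc, add_assoc]

end Factor

end FactorModel

end

theorem lemma3p8 {Ω : Type*} {m : MeasurableSpace Ω} (Q : Measure Ω) [IsProbabilityMeasure Q]
    (𝓕 : Filtration ℝ≥0 m)
    (μ : Fin 3 → ℝ) (C : Matrix (Fin 2) (Fin 2) ℝ) (S Γ : Matrix (Fin 3) (Fin 3) ℝ)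
    (W X : ℝ≥0 → Ω → Fin 3 → ℝ)
    (hW : FactorModel.IsBrownian3 Q 𝓕 Γ W)
    (hX : FactorModel.IsFactorProcess Q 𝓕 μ C S W X)
    (hX0 : ∀ z : Fin 3 → ℝ, Integrable (fun ω => Real.exp (z ⬝ᵥ X 0 ω)) Q) :
    FactorModel.IsExpAffine Q 𝓕 X ∧
    FactorModel.IsExpAffineWith Q 𝓕 X
      (fun t T z => (FactorModel.semigroup C ((T : ℝ) - (t : ℝ)))ᵀ *ᵥ z)
      (fun t T z => FactorModel.scalarCoeff μ C S Γ ((T : ℝ) - (t : ℝ)) z) := by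
  have hsub : Continuous fun p : ℝ≥0 × ℝ≥0 => (p.2 : ℝ) - (p.1 : ℝ) := by fun_prop
  have key : FactorModel.IsExpAffineWith Q 𝓕 X
      (fun t T z => (FactorModel.semigroup C ((T : ℝ) - (t : ℝ)))ᵀ *ᵥ z)
      (fun t T z => FactorModel.scalarCoeff μ C S Γ ((T : ℝ) - (t : ℝ)) z) :=
    { exp_moment := hX.integrable_exp_dotProduct hW hX0
      measurable_vec := fun z =>
        ((FactorModel.continuous_semigroup_transpose_mulVec C z).comp hsub).measurable
      measurable_scalar := fun z =>
        ((intervalIntegral.continuous_primitive (fun a b =>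
          (FactorModel.continuous_integrand μ C S Γ z).intervalIntegrable a b) 0).comp
            hsub).measurable
      condExp_eq := fun z _ _ hT => hX.condExp_exp_dotProduct hW hX0 z hT }
  exact ⟨⟨_, _, key⟩, key⟩
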